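/- Let $A$ be a non-unital $\sigma$-unital $C^*$-algebra with multiplier algebra $M(A)$, and let $E$ be a (complete) right Hilbert $C^*$-module over $A$. For a $C^*$-subalgebra $B\subseteq M(A)$ containing $A$ and the identity of $M(A)$ (a unitisation of $A$), say that $E$ is *$B$-finite projective* if there are $n\in\mathbb N$ and a projection $p\in M_n(B)$ such that $E\cong pA^n$ as right Hilbert $A$-modules. Let $\operatorname{End}_A(E)$ be the $C^*$-algebra of adjointable operators on $E$, and let $M(E)=\operatorname{Hom}_A(A,E)$ be the multiplier module of $E$, that is, the space of adjointable operators $A\to E$. It is a right $M(A)$-module through $(m\cdot b)(a)=m(ba)$, and it carries the $\operatorname{End}_A(E)$-valued left inner product $\langle e, f\rangle=\Theta_{e,f}=e f^*$. The following are equivalent: 1. There is a finite subset $F\subseteq M(A)$ such that $A_b:=C^*(A\cup F)\subseteq M(A)$ contains the identity of $M(A)$ and $E$ is $A_b$-finite projective. 2. $E$ is $M(A)$-finite projective. 3. $M(E)$ is finitely generated and projective as a right $M(A)$-module. 4. $M(E)$ is full as a left Hilbert $\operatorname{End}_A(E)$-module: the closed linear span of $\{e f^* : e,f\in M(E)\}$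 is all of $\operatorname{End}_A(E)$. -/

import Mathlib

open scoped MultiplierAlgebra

/-! Right Hilbert C⋆-modules over a C⋆-algebra `A` are Mathlib's `CStarModule`s over the opposite
algebra `Aᵐᵒᵖ`: the right action is `x · a = MulOpposite.op a • x`, and the `A`-valued inner product
is conjugate linear in the first variable and satisfies `(x | y · a) = (x | y) a`. -/

namespace RightHilbert

/-- The `A`-valued inner product `(x | y)` of a right Hilbert `A`-module. -/
def rinner (A : Type*) {E : Type*} [NonUnitalCStarAlgebra A] [PartialOrder A]
    [NormedAddCommGroup E] [NormedSpace ℂ E] [SMul Aᵐᵒᵖ E] [CStarModule Aᵐᵒᵖ E] (x y : E) : A :=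
  MulOpposite.unop (inner Aᵐᵒᵖ x y)

/-- The C⋆-algebra `A` as a right Hilbert module over itself, `(a | b) = a⋆ b`. -/
noncomputable instance selfModule (A : Type*) [NonUnitalCStarAlgebra A] [PartialOrder A]
    [StarOrderedRing A] : CStarModule Aᵐᵒᵖ A where
  inner x y := MulOpposite.op (star x * y)
  inner_add_right := by intros; simp [mul_add]
  inner_self_nonneg := by intro x; simp
  inner_self := by intro x; simp
  inner_op_smul_right := by
    intro a x y
    apply MulOpposite.unop_injective
    change star x * (y * a.unop) = (star x * y) * a.unop
    rw [mul_assoc]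
  inner_smul_right_complex := by
    intro z x y
    apply MulOpposite.unop_injective
    change star x * (z • y) = z • (star x * y)
    rw [mul_smul_comm]
  star_inner x y := by
    apply MulOpposite.unop_injective
    change star (star x * y) = star y * x
    simp
  norm_eq_sqrt_norm_inner_self x := by
    rw [MulOpposite.norm_op, CStarRing.norm_star_mul_self, Real.sqrt_mul_self (norm_nonneg x)]

theorem rinner_self_eq (A : Type*) [NonUnitalCStarAlgebra A] [PartialOrder A]
    [StarOrderedRing A] (a b : A) : rinner A a b = star a * b := rfl

section Basic

variable {A E : Type*} [NonUnitalCStarAlgebra A] [PartialOrder A]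
  [NormedAddCommGroup E] [NormedSpace ℂ E] [SMul Aᵐᵒᵖ E] [CStarModule Aᵐᵒᵖ E]

theorem star_rinner (x y : E) : star (rinner A x y) = rinner A y x :=
  congrArg MulOpposite.unop (CStarModule.star_inner (A := Aᵐᵒᵖ) x y)

theorem rinner_add_right (x y z : E) : rinner A x (y + z) = rinner A x y + rinner A x z :=
  congrArg MulOpposite.unop (CStarModule.inner_add_right (A := Aᵐᵒᵖ))

theorem rinner_smul_right (c : ℂ) (x y : E) : rinner A x (c • y) = c • rinner A x y :=
  congrArg MulOpposite.unop (CStarModule.inner_smul_right_complex (A := Aᵐᵒᵖ))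

theorem rinner_add_left (x y z : E) : rinner A (x + y) z = rinner A x z + rinner A y z := by
  rw [← star_rinner, rinner_add_right, star_add, star_rinner, star_rinner]

theorem rinner_smul_left (c : ℂ) (x y : E) : rinner A (c • x) y = star c • rinner A x y := by
  rw [← star_rinner, rinner_smul_right, star_smul, star_rinner]

theorem rinner_zero_right (x : E) : rinner A x 0 = 0 := by
  have h := rinner_smul_right (A := A) (0 : ℂ) x 0
  simpa using h

theorem rinner_zero_left (x : E) : rinner A 0 x = 0 := by
  rw [← star_rinner, rinner_zero_right, star_zero]

end Basic

/-- `Hom_A(E, F)`: the space of adjointable operators from `E` to `F`, normed by the operator norm.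
(On complete modules, an adjointable map and its adjoint are automatically linear, bounded and
`A`-linear.) -/
def adjointables (A E F : Type*) [NonUnitalCStarAlgebra A] [PartialOrder A]
    [NormedAddCommGroup E] [NormedSpace ℂ E] [SMul Aᵐᵒᵖ E] [CStarModule Aᵐᵒᵖ E]
    [NormedAddCommGroup F] [NormedSpace ℂ F] [SMul Aᵐᵒᵖ F] [CStarModule Aᵐᵒᵖ F] :
    Submodule ℂ (E →L[ℂ] F) where
  carrier := {T | ∃ S : F →L[ℂ] E, ∀ x y, rinner A (T x) y = rinner A x (S y)}
  add_mem' := by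
    rintro T T' ⟨S, hS⟩ ⟨S', hS'⟩
    exact ⟨S + S', fun x y => by simp [rinner_add_left, rinner_add_right, hS, hS']⟩
  zero_mem' := ⟨0, fun x y => by simp [rinner_zero_left, rinner_zero_right]⟩
  smul_mem' := by
    rintro c T ⟨S, hS⟩
    exact ⟨star c • S, fun x y => by
      simp only [smul_apply, rinner_smul_left, rinner_smul_right, hS]⟩

section Adjoint

variable {A E F : Type*} [NonUnitalCStarAlgebra A] [PartialOrder A]
    [NormedAddCommGroup E] [NormedSpace ℂ E] [SMul Aᵐᵒᵖ E] [CStarModule Aᵐᵒᵖ E]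
    [NormedAddCommGroup F] [NormedSpace ℂ F] [SMul Aᵐᵒᵖ F] [CStarModule Aᵐᵒᵖ F]

/-- The adjoint `T⋆ : F → E` of an adjointable operator `T : E → F`; it is unique, since the inner
product of `E` is definite. -/
noncomputable def adjoint (T : adjointables A E F) : F →L[ℂ] E := Classical.choose T.2

theorem rinner_adjoint_right (T : adjointables A E F) (x : E) (y : F) :
    rinner A (T.1 x) y = rinner A x (adjoint T y) := Classical.choose_spec T.2 x y

theorem rinner_adjoint_left (T : adjointables A E F) (x : E) (y : F) :
    rinner A (adjoint T y) x = rinner A y (T.1 x) := by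
  rw [← star_rinner, ← rinner_adjoint_right, star_rinner]

end Adjoint

/-- `End_A(E)`: the C⋆-algebra of adjointable operators on `E`, with the operator norm. -/
abbrev End (A E : Type*) [NonUnitalCStarAlgebra A] [PartialOrder A]
    [NormedAddCommGroup E] [NormedSpace ℂ E] [SMul Aᵐᵒᵖ E] [CStarModule Aᵐᵒᵖ E] : Type _ :=
  adjointables A E E

/-- The multiplier module `M(E) = Hom_A(A, E)` of `E`. -/
abbrev MultiplierModule (A E : Type*) [NonUnitalCStarAlgebra A] [PartialOrder A]
    [StarOrderedRing A] [NormedAddCommGroup E] [NormedSpace ℂ E] [SMul Aᵐᵒᵖ E]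
    [CStarModule Aᵐᵒᵖ E] : Type _ :=
  adjointables A A E

/-- A multiplier `b` of `A`, acting on `A` from the left as `b.fst`, is adjointable, and its
adjoint is the action of `b⋆`. -/
theorem star_fst_mul {A : Type*} [NonUnitalCStarAlgebra A] (b : 𝓜(ℂ, A)) (a c : A) :
    star (b.fst a) * c = star a * (star b).fst c := by
  rw [DoubleCentralizer.star_fst, ← star_mul, b.central, star_mul, star_star]

section Multiplier

variable {A E : Type*} [NonUnitalCStarAlgebra A] [PartialOrder A] [StarOrderedRing A]
    [NormedAddCommGroup E] [NormedSpace ℂ E] [SMul Aᵐᵒᵖ E] [CStarModule Aᵐᵒᵖ E]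

/-- The right action of `M(A)` on `M(E)`: `(m · b)(a) = m (b a)`. -/
noncomputable def rightMul (m : MultiplierModule A E) (b : 𝓜(ℂ, A)) : MultiplierModule A E :=
  ⟨m.1.comp b.fst, (star b).fst.comp (adjoint m), fun a x => by
    rw [ContinuousLinearMap.comp_apply, rinner_adjoint_right, rinner_self_eq, star_fst_mul,
      rinner_self_eq, ContinuousLinearMap.comp_apply]⟩

/-- `M(E)` is a right `M(A)`-module. -/
noncomputable instance instModuleMultiplier :
    Module (𝓜(ℂ, A))ᵐᵒᵖ (MultiplierModule A E) where
  smul b m := rightMul m b.unop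
  one_smul _ := rfl
  mul_smul _ _ _ := rfl
  smul_zero _ := rfl
  smul_add _ _ _ := rfl
  add_smul b c m := by
    apply Subtype.ext
    ext a
    exact map_add m.1 (b.unop.fst a) (c.unop.fst a)
  zero_smul m := by
    apply Subtype.ext
    ext a
    exact map_zero m.1

/-- The left inner product of `M(E)` with values in `End_A(E)`: it sends `e, f` to the operator
`Θ_{e,f} = e f⋆` on `E`, that is, to `g ↦ e · (f | g)` where `(f | g) = f⋆ g`. -/
noncomputable def leftInner (e f : MultiplierModule A E) : End A E :=
  ⟨e.1.comp (adjoint f), f.1.comp (adjoint e), fun x y => by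
    rw [ContinuousLinearMap.comp_apply, rinner_adjoint_right, rinner_adjoint_left,
      ContinuousLinearMap.comp_apply]⟩

variable (A E) in
/-- `M(E)` is full as a left `End_A(E)`-module: the closed linear span of the values of the left
inner product is all of `End_A(E)`. -/
def IsLeftFull : Prop :=
  (Submodule.span ℂ (Set.range fun q : MultiplierModule A E × MultiplierModule A E =>
    leftInner q.1 q.2)).topologicalClosure = ⊤

end Multiplier

section FiniteProjective

variable {A : Type*} [NonUnitalCStarAlgebra A]

/-- The action of an `n × n` matrix over `M(A)` on `Aⁿ`: `(p v)ᵢ = ∑ⱼ pᵢⱼ vⱼ`. -/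
noncomputable def matrixAct {n : ℕ} (p : Matrix (Fin n) (Fin n) 𝓜(ℂ, A)) :
    (Fin n → A) →ₗ[ℂ] (Fin n → A) where
  toFun v i := ∑ j, (p i j).fst (v j)
  map_add' v w := by ext i; simp [Finset.sum_add_distrib]
  map_smul' c v := by ext i; simp [Finset.smul_sum]

/-- `p Aⁿ`. It is used below with the right action and the inner product of `Aⁿ`, which are
`(v · a)ᵢ = vᵢ a` and `(v | w) = ∑ᵢ vᵢ⋆ wᵢ`. -/
noncomputable def projRange {n : ℕ} (p : Matrix (Fin n) (Fin n) 𝓜(ℂ, A)) :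
    Submodule ℂ (Fin n → A) := LinearMap.range (matrixAct p)

/-- `E ≅ p Aⁿ` as right Hilbert `A`-modules: there is an `A`-linear bijection that preserves the
inner products. -/
def IsoProjRange [PartialOrder A] (E : Type*)
    [NormedAddCommGroup E] [NormedSpace ℂ E] [SMul Aᵐᵒᵖ E] [CStarModule Aᵐᵒᵖ E]
    {n : ℕ} (p : Matrix (Fin n) (Fin n) 𝓜(ℂ, A)) : Prop :=
  ∃ φ : E ≃ₗ[ℂ] projRange p,
    (∀ (x : E) (a : A) (i : Fin n), (φ (MulOpposite.op a • x)).1 i = (φ x).1 i * a) ∧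
    ∀ x y : E, ∑ i, star ((φ x).1 i) * (φ y).1 i = rinner A x y

/-- A C⋆-subalgebra of `M(A)` that contains `A` and the identity of `M(A)`. Then `A` is an
essential ideal in it, because `A` is an essential ideal of `M(A)`. -/
structure IsUnitisation (B : NonUnitalStarSubalgebra ℂ 𝓜(ℂ, A)) : Prop where
  isClosed : IsClosed (B : Set 𝓜(ℂ, A))
  coe_mem : ∀ a : A, (a : 𝓜(ℂ, A)) ∈ B
  one_mem : (1 : 𝓜(ℂ, A)) ∈ B

/-- `E` is `B`-finite projective, for a unitisation `B ⊆ M(A)` of `A`: it is isomorphic to `p Aⁿ`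
for some `n` and some projection `p ∈ Mₙ(B)`. -/
structure IsFiniteProjective [PartialOrder A] (B : NonUnitalStarSubalgebra ℂ 𝓜(ℂ, A)) (E : Type*)
    [NormedAddCommGroup E] [NormedSpace ℂ E] [SMul Aᵐᵒᵖ E] [CStarModule Aᵐᵒᵖ E] : Prop where
  isUnitisation : IsUnitisation B
  exists_iso : ∃ (n : ℕ) (p : Matrix (Fin n) (Fin n) 𝓜(ℂ, A)),
    IsStarProjection p ∧ (∀ i j, p i j ∈ B) ∧ IsoProjRange E p

/-- `C⋆(A ∪ F)`: the C⋆-subalgebra of `M(A)` generated by `A` and a set `F` of multipliers. -/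
noncomputable def generated (F : Set 𝓜(ℂ, A)) : NonUnitalStarSubalgebra ℂ 𝓜(ℂ, A) :=
  (NonUnitalStarAlgebra.adjoin ℂ
    (Set.range (fun a : A => (a : 𝓜(ℂ, A))) ∪ F)).topologicalClosure

end FiniteProjective

/-- `A` has an identity element. -/
def HasUnit (A : Type*) [NonUnitalCStarAlgebra A] : Prop :=
  ∃ e : A, ∀ a : A, e * a = a ∧ a * e = a

/-- `A` is `σ`-unital: it has a sequential approximate unit that consists of positive
contractions. -/
def IsSigmaUnital (A : Type*) [NonUnitalCStarAlgebra A] [PartialOrder A] : Prop :=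
  ∃ u : ℕ → A, (∀ k, 0 ≤ u k ∧ ‖u k‖ ≤ 1) ∧
    ∀ a : A, Filter.Tendsto (fun k => u k * a) Filter.atTop (nhds a) ∧
      Filter.Tendsto (fun k => a * u k) Filter.atTop (nhds a)

end RightHilbert

/-!
Each of the four conditions is equivalent to the existence of a finite Parseval frame: multipliers
`e₁, …, eₙ ∈ M(E)` with `∑ᵢ eᵢ eᵢ⋆ = 1` in `End_A(E)`.

From a frame one gets everything by direct formulas. The matrix `(eᵢ⋆ eⱼ)` is a projection over
`M(A)`, and `x ↦ (eᵢ⋆ x)` maps `E` onto its range; the finitely many entries, together with `1`,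
generate a suitable `A_b`. The expansion `m = ∑ᵢ eᵢ (eᵢ⋆ m)` splits `M(A)ⁿ → M(E)`, and
`T = ∑ᵢ (T eᵢ) eᵢ⋆` shows that `M(E)` is full. Conversely, an isomorphism `E ≅ p Aⁿ` turns the
columns of `p` into a frame.

The remaining implications, from algebraic finite generation and from fullness, both go through
`hasParsevalFrame_of_norm_le`: it suffices to find `m₁, …, mₙ ∈ M(E)` and constants with
`‖x‖ ≤ ∑ᵢ Kᵢ ‖mᵢ⋆ x‖` on `E`. Indeed `S = ∑ᵢ mᵢ mᵢ⋆` is then a positive element of the C⋆-algebra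
`End_A(E)` that is bounded below, so it is invertible and the `S^(-1/2) mᵢ` form a frame. For a full
`M(E)` the estimate holds because some `∑ᵢ xᵢ mᵢ⋆` is within `1/2` of the identity. For a finitely
generated `M(E)` it follows from the open mapping theorem for `M(A)ⁿ → M(E)`, evaluated along an
approximate unit of `A`.
-/

namespace RightHilbert

/-! ### Hilbert modules and their adjointable operators -/

/-- The opposite of a C⋆-algebra, the ring of scalars in the encoding of right modules, is a
C⋆-algebra. -/
noncomputable instance mulOppositeCStarAlgebra (A : Type*) [NonUnitalCStarAlgebra A] :
    NonUnitalCStarAlgebra Aᵐᵒᵖ where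
  norm_mul_self_le x := by
    rw [← MulOpposite.norm_unop x, ← MulOpposite.norm_unop (star x * x)]
    exact (CStarRing.norm_self_mul_star (x := x.unop)).ge

instance mulOppositeStarOrderedRing (A : Type*) [NonUnitalCStarAlgebra A] [PartialOrder A]
    [StarOrderedRing A] : StarOrderedRing Aᵐᵒᵖ :=
  .of_nonneg_iff' (fun {x y} h z => by
      rw [← MulOpposite.unop_le_unop] at h ⊢
      exact add_le_add_right h _)
    (fun x => by
      rw [← MulOpposite.unop_le_unop, MulOpposite.unop_zero,
        CStarAlgebra.nonneg_iff_eq_star_mul_self]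
      constructor
      · rintro ⟨s, hs⟩
        exact ⟨.op (star s), MulOpposite.unop_injective (by simpa using hs)⟩
      · rintro ⟨s, rfl⟩
        exact ⟨star s.unop, by simp⟩)

section Basic

variable {A E : Type*} [NonUnitalCStarAlgebra A] [PartialOrder A]
  [NormedAddCommGroup E] [NormedSpace ℂ E] [SMul Aᵐᵒᵖ E] [CStarModule Aᵐᵒᵖ E]

theorem rinner_op_smul_right (x y : E) (a : A) :
    rinner A x (MulOpposite.op a • y) = rinner A x y * a :=
  congrArg MulOpposite.unop (CStarModule.inner_op_smul_right (A := Aᵐᵒᵖ))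

theorem rinner_op_smul_left (x y : E) (a : A) :
    rinner A (MulOpposite.op a • x) y = star a * rinner A x y := by
  rw [← star_rinner, rinner_op_smul_right, star_mul, star_rinner]

theorem rinner_neg_right (x y : E) : rinner A x (-y) = -rinner A x y := by
  simpa using rinner_smul_right (A := A) (-1 : ℂ) x y

theorem rinner_sub_right (x y z : E) : rinner A x (y - z) = rinner A x y - rinner A x z := by
  rw [sub_eq_add_neg, rinner_add_right, rinner_neg_right, sub_eq_add_neg]

theorem rinner_sum_right {ι : Type*} (s : Finset ι) (x : E) (y : ι → E) :
    rinner A x (∑ i ∈ s, y i) = ∑ i ∈ s, rinner A x (y i) := by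
  classical
  induction s using Finset.induction_on with
  | empty => simp [rinner_zero_right]
  | insert i s hi ih => rw [Finset.sum_insert hi, Finset.sum_insert hi, rinner_add_right, ih]

theorem rinner_self_eq_zero {x : E} : rinner A x x = 0 ↔ x = 0 := by
  rw [← CStarModule.inner_self (A := Aᵐᵒᵖ) (x := x), rinner, MulOpposite.unop_eq_zero_iff]

theorem rinner_self_nonneg (x : E) : 0 ≤ rinner A x x :=
  CStarModule.inner_self_nonneg (A := Aᵐᵒᵖ) (x := x)

variable (A) in
theorem norm_sq_eq_norm_rinner (x : E) : ‖x‖ ^ 2 = ‖rinner A x x‖ :=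
  CStarModule.norm_sq_eq Aᵐᵒᵖ

variable (A) in
theorem norm_rinner_le [StarOrderedRing A] (x y : E) : ‖rinner A x y‖ ≤ ‖x‖ * ‖y‖ :=
  CStarModule.norm_inner_le (A := Aᵐᵒᵖ) E

variable (A) in
theorem ext_rinner_left {x y : E} (h : ∀ z : E, rinner A z x = rinner A z y) : x = y := by
  rw [← sub_eq_zero, ← rinner_self_eq_zero (A := A), rinner_sub_right, h, sub_self]

end Basic

section Adjoint

variable {A E F G : Type*} [NonUnitalCStarAlgebra A] [PartialOrder A]
    [NormedAddCommGroup E] [NormedSpace ℂ E] [SMul Aᵐᵒᵖ E] [CStarModule Aᵐᵒᵖ E]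
    [NormedAddCommGroup F] [NormedSpace ℂ F] [SMul Aᵐᵒᵖ F] [CStarModule Aᵐᵒᵖ F]
    [NormedAddCommGroup G] [NormedSpace ℂ G] [SMul Aᵐᵒᵖ G] [CStarModule Aᵐᵒᵖ G]

theorem adjoint_eq_of_forall {T : adjointables A E F} {S : F →L[ℂ] E}
    (h : ∀ x y, rinner A (T.1 x) y = rinner A x (S y)) : adjoint T = S := by
  ext y
  exact ext_rinner_left A fun z => by rw [← rinner_adjoint_right, h]

/-- An adjointable operator commutes with the action of `A`, whether or not that was assumed:
this follows from the existence of the adjoint. -/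
theorem map_op_smul (T : adjointables A E F) (x : E) (a : A) :
    T.1 (MulOpposite.op a • x) = MulOpposite.op a • T.1 x :=
  ext_rinner_left A fun z => by
    rw [← rinner_adjoint_left, rinner_op_smul_right, rinner_op_smul_right, rinner_adjoint_left]

/-- The adjoint, as an adjointable operator. -/
noncomputable def adj (T : adjointables A E F) : adjointables A F E :=
  ⟨adjoint T, T.1, fun x y => rinner_adjoint_left T y x⟩

@[simp] theorem coe_adj (T : adjointables A E F) : (adj T).1 = adjoint T := rfl

@[simp] theorem adjoint_adj (T : adjointables A E F) : adjoint (adj T) = T.1 :=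
  adjoint_eq_of_forall fun x y => rinner_adjoint_left T y x

@[simp] theorem adj_adj (T : adjointables A E F) : adj (adj T) = T :=
  Subtype.ext (adjoint_adj T)

/-- The composition of adjointable operators. -/
noncomputable def comp (T : adjointables A F G) (S : adjointables A E F) : adjointables A E G :=
  ⟨T.1.comp S.1, (adjoint S).comp (adjoint T), fun x y => by
    rw [ContinuousLinearMap.comp_apply, ContinuousLinearMap.comp_apply, rinner_adjoint_right,
      rinner_adjoint_right]⟩

@[simp] theorem coe_comp (T : adjointables A F G) (S : adjointables A E F) :
    (comp T S).1 = T.1.comp S.1 := rfl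

theorem adj_comp (T : adjointables A F G) (S : adjointables A E F) :
    adj (comp T S) = comp (adj S) (adj T) :=
  Subtype.ext <| adjoint_eq_of_forall fun x y => by
    simp [rinner_adjoint_right]

theorem adj_add (T S : adjointables A E F) : adj (T + S) = adj T + adj S :=
  Subtype.ext <| adjoint_eq_of_forall fun x y => by
    simp [rinner_adjoint_right, rinner_add_left, rinner_add_right]

theorem adj_smul (c : ℂ) (T : adjointables A E F) : adj (c • T) = star c • adj T :=
  Subtype.ext <| adjoint_eq_of_forall fun x y => by
    simp [rinner_adjoint_right, rinner_smul_left, rinner_smul_right]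

theorem norm_apply_sq_le [StarOrderedRing A] (T : adjointables A E F) (x : E) :
    ‖T.1 x‖ ^ 2 ≤ ‖x‖ * ‖adjoint T (T.1 x)‖ := by
  rw [norm_sq_eq_norm_rinner A, rinner_adjoint_right]
  exact norm_rinner_le A _ _

theorem norm_le_norm_adj [StarOrderedRing A] (T : adjointables A E F) : ‖T‖ ≤ ‖adj T‖ := by
  refine ContinuousLinearMap.opNorm_le_bound T.1 (norm_nonneg _) fun x => ?_
  have h1 := norm_apply_sq_le T x
  have h2 : ‖adjoint T (T.1 x)‖ ≤ ‖adj T‖ * ‖T.1 x‖ := (adjoint T).le_opNorm _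
  rcases (norm_nonneg (T.1 x)).eq_or_lt with h | h
  · rw [← h]; positivity
  · refine le_of_mul_le_mul_right ?_ h
    nlinarith [mul_le_mul_of_nonneg_left h2 (norm_nonneg x)]

theorem norm_adj [StarOrderedRing A] (T : adjointables A E F) : ‖adj T‖ = ‖T‖ :=
  le_antisymm (by simpa using norm_le_norm_adj (adj T)) (norm_le_norm_adj T)

/-- The C⋆-identity for adjointable operators between two modules. -/
theorem norm_sq_le_norm_adj_comp [StarOrderedRing A] (T : adjointables A E F) :
    ‖T‖ * ‖T‖ ≤ ‖comp (adj T) T‖ := by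
  have h : ‖T‖ ≤ √‖comp (adj T) T‖ := by
    refine ContinuousLinearMap.opNorm_le_bound T.1 (Real.sqrt_nonneg _) fun x => ?_
    refine abs_le_of_sq_le_sq' ?_ (by positivity) |>.2
    rw [mul_pow, Real.sq_sqrt (norm_nonneg (comp (adj T) T))]
    have h2 : ‖adjoint T (T.1 x)‖ ≤ ‖comp (adj T) T‖ * ‖x‖ := (comp (adj T) T).1.le_opNorm x
    nlinarith [norm_apply_sq_le T x, mul_le_mul_of_nonneg_left h2 (norm_nonneg x)]
  calc ‖T‖ * ‖T‖ ≤ √‖comp (adj T) T‖ * √‖comp (adj T) T‖ := by gcongr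
    _ = _ := Real.mul_self_sqrt (norm_nonneg _)

/-- Adjointable operators form a closed subspace, because passing to the adjoint is isometric: the
adjoints of a convergent sequence of operators converge too. -/
instance completeSpace_adjointables [StarOrderedRing A] [CompleteSpace E] [CompleteSpace F] :
    CompleteSpace (adjointables A E F) := by
  refine Metric.complete_of_cauchySeq_tendsto fun u hu => ?_
  have hu' : CauchySeq fun k => (u k).1 := hu.map (adjointables A E F).subtypeL.uniformContinuous
  have hv : CauchySeq fun k => adjoint (u k) := by
    rw [Metric.cauchySeq_iff] at hu ⊢
    intro ε hε
    obtain ⟨N, hN⟩ := hu ε hε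
    refine ⟨N, fun m hm n hn => ?_⟩
    have h : adj (u m - u n) = adj (u m) - adj (u n) :=
      eq_sub_of_add_eq (by rw [← adj_add, sub_add_cancel])
    calc dist (adjoint (u m)) (adjoint (u n)) = ‖adj (u m - u n)‖ := by
          rw [dist_eq_norm, h]; rfl
      _ = dist (u m) (u n) := (norm_adj _).trans (dist_eq_norm _ _).symm
      _ < ε := hN m hm n hn
  obtain ⟨T, hT⟩ := cauchySeq_tendsto_of_complete hu'
  obtain ⟨S, hS⟩ := cauchySeq_tendsto_of_complete hv
  have hTx (x : E) : Filter.Tendsto (fun k => (u k).1 x) .atTop (nhds (T x)) :=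
    ((ContinuousLinearMap.apply ℂ F x).continuous.tendsto T).comp hT
  have hSy (y : F) : Filter.Tendsto (fun k => adjoint (u k) y) .atTop (nhds (S y)) :=
    ((ContinuousLinearMap.apply ℂ E y).continuous.tendsto S).comp hS
  refine ⟨⟨T, S, fun x y => ?_⟩, tendsto_subtype_rng.2 hT⟩
  apply MulOpposite.op_injective
  refine tendsto_nhds_unique (f := fun k => inner Aᵐᵒᵖ ((u k).1 x) y)
    (((CStarModule.continuous_inner (A := Aᵐᵒᵖ) (E := F)).tendsto (T x, y)).comp
      ((hTx x).prodMk_nhds tendsto_const_nhds)) ?_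
  have h := ((CStarModule.continuous_inner (A := Aᵐᵒᵖ) (E := E)).tendsto (x, S y)).comp
    ((tendsto_const_nhds (x := x)).prodMk_nhds (hSy y))
  refine h.congr fun k => ?_
  exact (congrArg MulOpposite.op (rinner_adjoint_right (u k) x y)).symm

end Adjoint

section EndAlgebra

variable {A E : Type*} [NonUnitalCStarAlgebra A] [PartialOrder A]
    [NormedAddCommGroup E] [NormedSpace ℂ E] [SMul Aᵐᵒᵖ E] [CStarModule Aᵐᵒᵖ E]

noncomputable instance : Mul (End A E) := ⟨comp⟩
noncomputable instance : One (End A E) := ⟨⟨.id ℂ E, .id ℂ E, fun _ _ => rfl⟩⟩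
noncomputable instance : Star (End A E) := ⟨adj⟩

@[simp] theorem End.mul_apply (S T : End A E) (x : E) : (S * T).1 x = S.1 (T.1 x) := rfl
@[simp] theorem End.one_apply (x : E) : (1 : End A E).1 x = x := rfl

theorem End.rinner_apply_left (T : End A E) (x y : E) :
    rinner A (T.1 x) y = rinner A x ((star T).1 y) := rinner_adjoint_right T x y

theorem End.ext {S T : End A E} (h : ∀ x, S.1 x = T.1 x) : S = T :=
  Subtype.ext (ContinuousLinearMap.ext h)

noncomputable instance : NormedRing (End A E) where
  __ := (inferInstance : NormedAddCommGroup (End A E))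
  mul_assoc _ _ _ := rfl
  one_mul _ := rfl
  mul_one _ := rfl
  left_distrib S _ _ := End.ext fun _ => map_add S.1 _ _
  right_distrib _ _ _ := rfl
  zero_mul _ := rfl
  mul_zero S := End.ext fun _ => map_zero S.1
  norm_mul_le S T := S.1.opNorm_comp_le T.1

noncomputable instance : NormedAlgebra ℂ (End A E) where
  __ := Algebra.ofModule (R := ℂ) (A := End A E) (fun _ _ _ => rfl)
    (fun _ S _ => End.ext fun _ => map_smul S.1 _ _)
  norm_smul_le c S := (norm_smul c S.1).le

/-- `End_A(E)` is a C⋆-algebra. -/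
noncomputable instance endCStarAlgebra [StarOrderedRing A] [CompleteSpace E] :
    CStarAlgebra (End A E) where
  star_involutive := adj_adj
  star_mul := adj_comp
  star_add := adj_add
  star_smul := adj_smul
  norm_mul_self_le := norm_sq_le_norm_adj_comp

end EndAlgebra

/-! ### Positive and invertible operators on a Hilbert module -/

/-- A self-adjoint element of a C⋆-algebra that is not a topological zero divisor is invertible. -/
theorem isUnit_of_norm_le_norm_mul {B : Type*} [CStarAlgebra B] {S : B} (hS : IsSelfAdjoint S)
    {C : ℝ} (hC : 0 < C) (h : ∀ T : B, ‖T‖ ≤ C * ‖S * T‖) : IsUnit S := by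
  rw [← spectrum.zero_notMem_iff ℝ]
  intro h0
  -- a bump at `0 ∈ σ(S)`, so narrow that `S f(S)` has norm less than `C⁻¹`
  set f : ℝ → ℝ := fun t => max 0 (1 - 2 * C * |t|) with hf
  have hfc : Continuous f := by fun_prop
  have h1 : (1 : ℝ) ≤ ‖cfc f S‖ := by
    simpa [hf] using norm_apply_le_norm_cfc f S h0 (ha := hS) (hf := hfc.continuousOn)
  have h2 : S * cfc f S = cfc (fun t => t * f t) S := by
    rw [cfc_mul (fun t => t) f S (hg := hfc.continuousOn), cfc_id' ℝ S]
  have h3 : ‖cfc (fun t => t * f t) S‖ ≤ (2 * C)⁻¹ := by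
    refine norm_cfc_le (by positivity) fun t _ => ?_
    rw [norm_mul, Real.norm_eq_abs, Real.norm_eq_abs]
    rcases le_total (1 - 2 * C * |t|) 0 with ht | ht
    · simp only [hf, max_eq_left ht, abs_zero, mul_zero]; positivity
    · have h4 : |t| ≤ (2 * C)⁻¹ := by
        rw [← one_div, le_div_iff₀ (by positivity)]; linarith
      simp only [hf, max_eq_right ht, abs_of_nonneg ht]
      have := abs_nonneg t
      nlinarith [mul_nonneg (mul_nonneg this this) hC.le]
  have h5 := h (cfc f S)
  rw [h2] at h5
  have h6 : C * ‖cfc (fun t => t * f t) S‖ ≤ C * (2 * C)⁻¹ := by gcongr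
  have h7 : C * (2 * C)⁻¹ = 1 / 2 := by field_simp
  linarith

section Frames

variable {A E : Type*} [NonUnitalCStarAlgebra A] [PartialOrder A] [StarOrderedRing A]
    [NormedAddCommGroup E] [NormedSpace ℂ E]
    [SMul Aᵐᵒᵖ E] [CStarModule Aᵐᵒᵖ E]

/-- A self-adjoint operator with positive expectation values is positive in the C⋆-algebra
`End_A(E)`: the expectation values at the range of its negative part are negative. -/
theorem End.nonneg_of_rinner_nonneg [CompleteSpace E]
    [PartialOrder (End A E)] [StarOrderedRing (End A E)]
    {T : End A E} (hT : IsSelfAdjoint T) (h : ∀ x, 0 ≤ rinner A x (T.1 x)) : 0 ≤ T := by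
  set N : End A E := T⁻ with hN
  have hN0 : 0 ≤ N := CFC.negPart_nonneg T
  have hTN : T * N = -(N * N) := by
    conv_lhs => rw [← CFC.posPart_sub_negPart T hT, sub_mul, CFC.posPart_mul_negPart, zero_sub]
  set s : End A E := CFC.sqrt N
  have hss : s * s = N := CFC.sqrt_mul_sqrt_self N
  have hs : star s = s := (CFC.sqrt_nonneg N).isSelfAdjoint
  have hNs : star N = N := hN0.isSelfAdjoint
  have key (x : E) : N.1 x = 0 := by
    have h1 : s.1 (N.1 x) = 0 := by
      rw [← rinner_self_eq_zero (A := A)]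
      refine le_antisymm ?_ (rinner_self_nonneg _)
      have h2 := h (N.1 x)
      rw [← End.mul_apply, hTN] at h2
      rw [End.rinner_apply_left, hs, ← End.mul_apply, hss]
      have h3 : (-(N * N)).1 x = -(N.1 (N.1 x)) := rfl
      rw [h3, rinner_neg_right] at h2
      exact neg_nonneg.1 h2
    rw [← rinner_self_eq_zero (A := A), End.rinner_apply_left, hNs]
    nth_rw 1 [← hss]
    rw [End.mul_apply, h1, map_zero, rinner_zero_right]
  exact (CFC.negPart_eq_zero_iff T hT).1 (End.ext key)

/-- A finite Parseval frame of `E`: multipliers `eᵢ ∈ M(E)` with `∑ᵢ eᵢ eᵢ⋆ = 1`. -/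
def IsParsevalFrame {ι : Type*} [Fintype ι] (e : ι → MultiplierModule A E) : Prop :=
  ∀ x, ∑ i, (e i).1 (adjoint (e i) x) = x

variable (A E) in
/-- `E` has a finite Parseval frame. -/
def HasParsevalFrame : Prop :=
  ∃ (n : ℕ) (e : Fin n → MultiplierModule A E), IsParsevalFrame e

theorem adjoint_leftInner (e f : MultiplierModule A E) :
    adjoint (leftInner e f) = (leftInner f e).1 :=
  adjoint_eq_of_forall fun x y => by
    change rinner A (e.1 (adjoint f x)) y = rinner A x (f.1 (adjoint e y))
    rw [rinner_adjoint_right, rinner_adjoint_left]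

/-- A finite family in `M(E)` that controls the norm of `E` can be corrected to a Parseval frame:
the hypothesis makes `S = ∑ᵢ mᵢ mᵢ⋆` bounded below, hence invertible, and the frame consists of
the multipliers `S^(-1/2) mᵢ`. -/
theorem hasParsevalFrame_of_norm_le [CompleteSpace E] {ι : Type*} [Fintype ι]
    (m : ι → MultiplierModule A E) (K : ι → ℝ)
    (h : ∀ x, ‖x‖ ≤ ∑ i, K i * ‖adjoint (m i) x‖) : HasParsevalFrame A E := by
  let : PartialOrder (End A E) := CStarAlgebra.spectralOrder _
  have : StarOrderedRing (End A E) := CStarAlgebra.spectralOrderedRing _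
  set S : End A E := ∑ i, leftInner (m i) (m i) with hSdef
  have hSapp (x : E) : S.1 x = ∑ i, (m i).1 (adjoint (m i) x) := by
    simp only [hSdef, AddSubmonoidClass.coe_finsetSum, sum_apply]
    rfl
  have hSin (x : E) :
      rinner A x (S.1 x) = ∑ i, rinner A (adjoint (m i) x) (adjoint (m i) x) := by
    rw [hSapp, rinner_sum_right]
    exact Finset.sum_congr rfl fun i _ => (rinner_adjoint_left _ _ _).symm
  have hSsa : IsSelfAdjoint S :=
    isSelfAdjoint_sum _ fun i _ => Subtype.ext (adjoint_leftInner (m i) (m i))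
  have hS0 : 0 ≤ S := End.nonneg_of_rinner_nonneg hSsa fun x => by
    rw [hSin]
    exact Finset.sum_nonneg fun i _ => rinner_self_nonneg _
  -- `‖mᵢ⋆ x‖² = ‖(mᵢ⋆ x | mᵢ⋆ x)‖ ≤ ‖(x | S x)‖`, the other summands being positive
  have hcoef (x : E) (i : ι) : ‖adjoint (m i) x‖ ≤ √(‖x‖ * ‖S.1 x‖) := by
    refine Real.le_sqrt_of_sq_le ?_
    rw [norm_sq_eq_norm_rinner A]
    refine (CStarAlgebra.norm_le_norm_of_nonneg_of_le (rinner_self_nonneg _) ?_).trans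
      (norm_rinner_le A x (S.1 x))
    rw [hSin]
    exact Finset.single_le_sum (f := fun i => rinner A (adjoint (m i) x) (adjoint (m i) x))
      (fun i _ => rinner_self_nonneg _) (Finset.mem_univ i)
  set L : ℝ := ∑ i, |K i| with hL
  have hL0 : 0 ≤ L := Finset.sum_nonneg fun i _ => abs_nonneg _
  -- combining both estimates, `‖x‖² ≤ L² ‖x‖ ‖S x‖`
  have hbelow (x : E) : ‖x‖ ≤ (L ^ 2 + 1) * ‖S.1 x‖ := by
    have h1 : ‖x‖ ≤ L * √(‖x‖ * ‖S.1 x‖) := by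
      refine (h x).trans ?_
      rw [hL, Finset.sum_mul]
      refine Finset.sum_le_sum fun i _ => ?_
      exact mul_le_mul (le_abs_self _) (hcoef x i) (norm_nonneg _) (abs_nonneg _)
    have h2 : ‖x‖ ^ 2 ≤ L ^ 2 * (‖x‖ * ‖S.1 x‖) := by
      calc ‖x‖ ^ 2 ≤ (L * √(‖x‖ * ‖S.1 x‖)) ^ 2 := by gcongr
        _ = _ := by rw [mul_pow, Real.sq_sqrt (by positivity)]
    rcases (norm_nonneg x).eq_or_lt with hx | hx
    · rw [← hx]; positivity
    · refine le_of_mul_le_mul_left ?_ hx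
      nlinarith [mul_nonneg hx.le (norm_nonneg (S.1 x))]
  have hSu : IsUnit S := by
    refine isUnit_of_norm_le_norm_mul hSsa (C := L ^ 2 + 1) (by positivity) fun T => ?_
    refine ContinuousLinearMap.opNorm_le_bound T.1 (by positivity) fun x => ?_
    refine (hbelow (T.1 x)).trans ?_
    rw [mul_assoc]
    gcongr
    exact (S * T).1.le_opNorm x
  have hconj := CFC.conjugate_rpow_neg_one_half S (hSu.isStrictlyPositive hS0)
  set R : End A E := S ^ (-(1 / 2) : ℝ)
  have hR : adj R = R := (CFC.rpow_nonneg (a := S)).isSelfAdjoint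
  have hframe : IsParsevalFrame fun i => comp R (m i) := fun x => by
    have h1 := congrArg (fun T : End A E => T.1 x) hconj
    simp only [End.mul_apply, End.one_apply, hSapp, map_sum] at h1
    refine Eq.trans (Finset.sum_congr rfl fun i _ => ?_) h1
    have h2 : adjoint (comp R (m i)) x = (adj (comp R (m i))).1 x := rfl
    rw [h2, adj_comp, hR]
    rfl
  refine ⟨Fintype.card ι, fun i => comp R (m ((Fintype.equivFin ι).symm i)), fun x => ?_⟩
  exact ((Fintype.equivFin ι).symm.sum_comp
    fun i => (comp R (m i)).1 (adjoint (comp R (m i)) x)).trans (hframe x)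

end Frames

/-! ### Multipliers of `A` as adjointable operators -/

section Multipliers

variable {A : Type*} [NonUnitalCStarAlgebra A]

theorem multiplier_ext {b c : 𝓜(ℂ, A)} (h : ∀ a, b.fst a = c.fst a) : b = c := by
  rw [← sub_eq_zero, ← norm_eq_zero, ← DoubleCentralizer.norm_fst, norm_eq_zero]
  ext a
  simp [h]

theorem sum_fst_apply {ι : Type*} (s : Finset ι) (b : ι → 𝓜(ℂ, A)) (a : A) :
    (∑ i ∈ s, b i).fst a = ∑ i ∈ s, (b i).fst a := by
  have h := congrArg Prod.fst (map_sum DoubleCentralizer.toProdHom b s)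
  rw [Prod.fst_sum] at h
  change (∑ i ∈ s, b i).fst = ∑ i ∈ s, (b i).fst at h
  rw [h, sum_apply]

variable [PartialOrder A] [StarOrderedRing A]

/-- An adjointable operator `T` on the Hilbert module `A`, as a multiplier: `T` is its left action,
and `a ↦ (T⋆ a⋆)⋆` is its right action. -/
noncomputable def toMultiplier (T : End A A) : 𝓜(ℂ, A) where
  fst := T.1
  snd :=
    { toFun := fun a => star (adjoint T (star a))
      map_add' := fun a b => by simp
      map_smul' := fun c a => by simp
      cont := by fun_prop }
  central x y := by
    have h := rinner_adjoint_left T y (star x)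
    rw [rinner_self_eq, rinner_self_eq, star_star] at h
    exact h

theorem star_toMultiplier (T : End A A) : star (toMultiplier T) = toMultiplier (adj T) :=
  multiplier_ext fun a => by
    rw [DoubleCentralizer.star_fst]
    change star (star (adjoint T (star (star a)))) = adjoint T a
    simp

end Multipliers

/-! ### Parseval frames and finite projectivity -/

section Frames

variable {A E : Type*} [NonUnitalCStarAlgebra A] [PartialOrder A] [StarOrderedRing A]
    [NormedAddCommGroup E] [NormedSpace ℂ E] [SMul Aᵐᵒᵖ E] [CStarModule Aᵐᵒᵖ E]

/-- A Parseval frame gives the projection `p = (eᵢ⋆ eⱼ)ᵢⱼ` over `M(A)`, and `x ↦ (eᵢ⋆ x)ᵢ`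
identifies `E` with `p Aⁿ`. -/
theorem IsParsevalFrame.exists_isoProjRange {n : ℕ} {e : Fin n → MultiplierModule A E}
    (he : IsParsevalFrame e) :
    ∃ p : Matrix (Fin n) (Fin n) 𝓜(ℂ, A), IsStarProjection p ∧ IsoProjRange E p := by
  set p : Matrix (Fin n) (Fin n) 𝓜(ℂ, A) :=
    .of fun i j => toMultiplier (comp (adj (e i)) (e j)) with hp
  have hpa (i j : Fin n) (a : A) : (p i j).fst a = adjoint (e i) ((e j).1 a) := rfl
  have hact (v : Fin n → A) (i : Fin n) :
      matrixAct p v i = adjoint (e i) (∑ j, (e j).1 (v j)) := by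
    rw [map_sum]; rfl
  refine ⟨p, ⟨?_, ?_⟩, ?_⟩
  · ext1 i j
    refine multiplier_ext fun a => ?_
    rw [Matrix.mul_apply, sum_fst_apply, hpa, ← he ((e j).1 a), map_sum]
    rfl
  · ext1 i j
    rw [Matrix.star_apply, hp, Matrix.of_apply, Matrix.of_apply, star_toMultiplier, adj_comp,
      adj_adj]
  · let φ : E →ₗ[ℂ] projRange p :=
      { toFun := fun x => ⟨fun i => adjoint (e i) x, fun i => adjoint (e i) x, by
          ext i; rw [hact, he]⟩
        map_add' := fun x y => by ext i; exact map_add (adjoint (e i)) x y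
        map_smul' := fun c x => by ext i; exact map_smul (adjoint (e i)) c x }
    have hφ : Function.Bijective φ := by
      refine ⟨fun x y h => ?_, ?_⟩
      · rw [← he x, ← he y]
        refine Finset.sum_congr rfl fun i _ => congrArg (e i).1 ?_
        exact congrFun (congrArg Subtype.val h) i
      · rintro ⟨_, v, rfl⟩
        refine ⟨∑ j, (e j).1 (v j), Subtype.ext (funext fun i => ?_)⟩
        exact (hact v i).symm
    refine ⟨.ofBijective φ hφ, fun x a i => map_op_smul (adj (e i)) x a, fun x y => ?_⟩
    conv_rhs => rw [← he y, rinner_sum_right]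
    exact Finset.sum_congr rfl fun i _ => rinner_adjoint_left (e i) (adjoint (e i) y) x

/-- If `E ≅ p Aⁿ`, then the operators `eᵢ : A → E` that correspond to the columns of `p` form a
Parseval frame; `eᵢ⋆` is the `i`-th coordinate. -/
theorem hasParsevalFrame_of_isoProjRange {n : ℕ} {p : Matrix (Fin n) (Fin n) 𝓜(ℂ, A)}
    (hp : IsStarProjection p) (h : IsoProjRange E p) : HasParsevalFrame A E := by
  obtain ⟨φ, -, hin⟩ := h
  have hfix (x : E) (i : Fin n) : ∑ j, (p i j).fst ((φ x).1 j) = (φ x).1 i := by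
    obtain ⟨v, hv⟩ := (φ x).2
    have h1 (k : Fin n) : (φ x).1 k = ∑ j, (p k j).fst (v j) := congrFun hv.symm k
    have h2 (j : Fin n) : (p i j).fst (v j) = ∑ k, (p i k).fst ((p k j).fst (v j)) := by
      conv_lhs => rw [← hp.isIdempotentElem.eq, Matrix.mul_apply, sum_fst_apply]
      rfl
    simp_rw [h1, map_sum]
    rw [Finset.sum_comm]
    exact Finset.sum_congr rfl fun j _ => (h2 j).symm
  have hstar (i j : Fin n) : star (p j i) = p i j := congrFun (congrFun hp.isSelfAdjoint i) j
  let e₀ (i : Fin n) : A →ₗ[ℂ] E := φ.symm.toLinearMap ∘ₗ (matrixAct p).rangeRestrict ∘ₗ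
    LinearMap.single ℂ (fun _ : Fin n => A) i
  let c₀ (i : Fin n) : E →ₗ[ℂ] A := LinearMap.proj i ∘ₗ (projRange p).subtype ∘ₗ φ.toLinearMap
  have hφe (i : Fin n) (a : A) (j : Fin n) : (φ (e₀ i a)).1 j = (p j i).fst a := by
    have h1 : φ (e₀ i a) = (matrixAct p).rangeRestrict (Pi.single i a) := φ.apply_symm_apply _
    rw [h1]
    change ∑ k, (p j k).fst ((Pi.single i a : Fin n → A) k) = _
    rw [Finset.sum_eq_single i (fun k _ hk => by simp [hk]) (by simp), Pi.single_eq_same]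
  have hadj (i : Fin n) (a : A) (x : E) : rinner A (e₀ i a) x = star a * c₀ i x := by
    rw [← hin]
    simp_rw [hφe, star_fst_mul, hstar]
    rw [← Finset.mul_sum, hfix]
    rfl
  have hc (i : Fin n) (x : E) : ‖c₀ i x‖ ≤ 1 * ‖x‖ := by
    rw [one_mul]
    refine le_of_sq_le_sq ?_ (norm_nonneg x)
    rw [norm_sq_eq_norm_rinner A x, ← hin, sq, ← CStarRing.norm_star_mul_self]
    exact CStarAlgebra.norm_le_norm_of_nonneg_of_le (star_mul_self_nonneg _) <|
      Finset.single_le_sum (f := fun j => star ((φ x).1 j) * (φ x).1 j)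
        (fun j _ => star_mul_self_nonneg _) (Finset.mem_univ i)
  have hecont (i : Fin n) (a : A) : ‖e₀ i a‖ ≤ 1 * ‖a‖ := by
    rw [one_mul]
    have h1 : ‖e₀ i a‖ ^ 2 ≤ ‖a‖ * ‖e₀ i a‖ := by
      rw [norm_sq_eq_norm_rinner A, hadj]
      refine (norm_mul_le _ _).trans ?_
      rw [norm_star]
      gcongr
      simpa using hc i (e₀ i a)
    rcases (norm_nonneg (e₀ i a)).eq_or_lt with h0 | h0
    · rw [← h0]; positivity
    · exact le_of_mul_le_mul_right (by rwa [sq] at h1) h0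
  let e (i : Fin n) : MultiplierModule A E :=
    ⟨(e₀ i).mkContinuous 1 (hecont i), (c₀ i).mkContinuous 1 (hc i), hadj i⟩
  have hea (i : Fin n) (x : E) : adjoint (e i) x = c₀ i x :=
    DFunLike.congr_fun (adjoint_eq_of_forall (T := e i) (S := (c₀ i).mkContinuous 1 (hc i))
      (hadj i)) x
  refine ⟨n, e, fun x => φ.injective (Subtype.ext (funext fun j => ?_))⟩
  simp_rw [hea]
  change ((projRange p).subtype ∘ₗ φ.toLinearMap) (∑ i, e₀ i (c₀ i x)) j = _
  rw [map_sum, Finset.sum_apply]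
  refine Eq.trans (Finset.sum_congr rfl fun i _ => ?_) (hfix x j)
  exact hφe i _ j

end Frames

/-! ### The characterisations of finite projectivity -/

theorem isUnitisation_top {A : Type*} [NonUnitalCStarAlgebra A] :
    IsUnitisation (⊤ : NonUnitalStarSubalgebra ℂ 𝓜(ℂ, A)) :=
  ⟨isClosed_univ, fun _ => trivial, trivial⟩

theorem IsFiniteProjective.mono {A E : Type*} [NonUnitalCStarAlgebra A] [PartialOrder A]
    [NormedAddCommGroup E] [NormedSpace ℂ E] [SMul Aᵐᵒᵖ E] [CStarModule Aᵐᵒᵖ E]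
    {B C : NonUnitalStarSubalgebra ℂ 𝓜(ℂ, A)}
    (h : IsFiniteProjective B E) (hBC : B ≤ C) (hC : IsUnitisation C) :
    IsFiniteProjective C E := by
  obtain ⟨n, p, hp, hB, hE⟩ := h.exists_iso
  exact ⟨hC, n, p, hp, fun i j => hBC (hB i j), hE⟩

section Characterisations

variable {A E : Type*} [NonUnitalCStarAlgebra A] [PartialOrder A] [StarOrderedRing A]
    [NormedAddCommGroup E] [NormedSpace ℂ E] [SMul Aᵐᵒᵖ E] [CStarModule Aᵐᵒᵖ E]

/-- The entries of the projection of a Parseval frame, together with `1`, generate over `A` a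
unitisation for which `E` is finite projective. -/
theorem exists_finite_isFiniteProjective_generated (h : HasParsevalFrame A E) :
    ∃ F : Set 𝓜(ℂ, A), F.Finite ∧ IsFiniteProjective (generated F) E := by
  obtain ⟨n, e, he⟩ := h
  obtain ⟨p, hp, hE⟩ := he.exists_isoProjRange
  have hsub (F : Set 𝓜(ℂ, A)) :
      Set.range (fun a : A => (a : 𝓜(ℂ, A))) ∪ F ⊆ (generated F : Set 𝓜(ℂ, A)) :=
    (NonUnitalStarAlgebra.subset_adjoin ℂ _).trans
      (NonUnitalStarSubalgebra.le_topologicalClosure _)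
  refine ⟨insert 1 (Set.range fun ij : Fin n × Fin n => p ij.1 ij.2),
    (Set.finite_range _).insert 1, ⟨?_, fun a => hsub _ (.inl ⟨a, rfl⟩), hsub _ ?_⟩,
    n, p, hp, fun i j => hsub _ ?_, hE⟩
  · exact NonUnitalStarSubalgebra.isClosed_topologicalClosure _
  · exact .inr (.inl rfl)
  · exact .inr (.inr ⟨(i, j), rfl⟩)

/-- `e⋆ m` as a multiplier, for `e, m ∈ M(E)`; as a function of `m` it is linear over the right
action of `M(A)`. -/
noncomputable def coefficient (e : MultiplierModule A E) :
    MultiplierModule A E →ₗ[(𝓜(ℂ, A))ᵐᵒᵖ] (𝓜(ℂ, A))ᵐᵒᵖ where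
  toFun m := .op (toMultiplier (comp (adj e) m))
  map_add' m m' := MulOpposite.unop_injective <| multiplier_ext fun a =>
    map_add (adjoint e) (m.1 a) (m'.1 a)
  map_smul' _ _ := MulOpposite.unop_injective <| multiplier_ext fun _ => rfl

/-- A Parseval frame expands each `m ∈ M(E)` as `m = ∑ᵢ eᵢ (eᵢ⋆ m)`, so `M(E)` is a direct summand
of a free module of finite rank. -/
theorem HasParsevalFrame.finite_and_projective (h : HasParsevalFrame A E) :
    Module.Finite (𝓜(ℂ, A))ᵐᵒᵖ (MultiplierModule A E) ∧
      Module.Projective (𝓜(ℂ, A))ᵐᵒᵖ (MultiplierModule A E) := by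
  obtain ⟨n, e, he⟩ := h
  let s := Fintype.linearCombination (𝓜(ℂ, A))ᵐᵒᵖ e
  let c : MultiplierModule A E →ₗ[(𝓜(ℂ, A))ᵐᵒᵖ] (Fin n → (𝓜(ℂ, A))ᵐᵒᵖ) :=
    LinearMap.pi fun i => coefficient (e i)
  have hsc : s ∘ₗ c = LinearMap.id := by
    ext1 m
    refine Subtype.ext (ContinuousLinearMap.ext fun a => ?_)
    rw [LinearMap.comp_apply, Fintype.linearCombination_apply, AddSubmonoidClass.coe_finsetSum,
      sum_apply]
    exact (Finset.sum_congr rfl fun i _ => rfl).trans (he (m.1 a))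
  exact ⟨.of_surjective s (LinearMap.surjective_of_comp_eq_id c s hsc), .of_split c s hsc⟩

/-- A Parseval frame expands each operator as `T = ∑ᵢ (T eᵢ) eᵢ⋆`. -/
theorem HasParsevalFrame.isLeftFull (h : HasParsevalFrame A E) : IsLeftFull A E := by
  obtain ⟨n, e, he⟩ := h
  refine top_unique fun T _ => Submodule.le_topologicalClosure _ ?_
  have hT : T = ∑ i, leftInner (comp T (e i)) (e i) := by
    refine End.ext fun x => ?_
    rw [AddSubmonoidClass.coe_finsetSum, sum_apply]
    conv_lhs => rw [← he x, map_sum]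
    rfl
  rw [hT]
  exact Submodule.sum_mem _ fun i _ => Submodule.subset_span ⟨(_, _), rfl⟩

/-- If `M(E)` is full, then some `R = ∑_q c_q x_q y_q⋆` is close enough to `1` to be bounded below,
so the family `y_q` controls the norm of `E`. -/
theorem IsLeftFull.hasParsevalFrame [CompleteSpace E] (h : IsLeftFull A E) :
    HasParsevalFrame A E := by
  have h1 : (1 : End A E) ∈ closure (Submodule.span ℂ (Set.range
      fun q : MultiplierModule A E × MultiplierModule A E => leftInner q.1 q.2) :
      Set (End A E)) := by
    rw [← Submodule.topologicalClosure_coe, h]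
    trivial
  obtain ⟨R, hR, hd⟩ := Metric.mem_closure_iff.1 h1 (1 / 2) (by norm_num)
  obtain ⟨c, rfl⟩ := Finsupp.mem_span_range_iff_exists_finsupp.1 hR
  refine hasParsevalFrame_of_norm_le (ι := c.support) (fun q => q.1.2)
    (fun q => 2 * (‖c q‖ * ‖q.1.1.1‖)) fun x => ?_
  set R := c.sum fun q a => a • leftInner q.1 q.2 with hRdef
  have hRx : R.1 x = ∑ q ∈ c.support, c q • q.1.1 (adjoint q.2 x) := by
    rw [hRdef, Finsupp.sum, AddSubmonoidClass.coe_finsetSum, sum_apply]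
    rfl
  have h2 : ‖R.1 x‖ ≤ ∑ q ∈ c.support, ‖c q‖ * ‖q.1.1‖ * ‖adjoint q.2 x‖ := by
    rw [hRx]
    refine norm_sum_le_of_le _ fun q _ => ?_
    rw [norm_smul, mul_assoc]
    gcongr
    exact q.1.1.le_opNorm _
  have h3 : ‖x - R.1 x‖ ≤ 1 / 2 * ‖x‖ := by
    rw [dist_eq_norm] at hd
    exact ((1 - R).1.le_opNorm x).trans (by gcongr; exact hd.le)
  have h4 : ‖x‖ ≤ ‖x - R.1 x‖ + ‖R.1 x‖ := by
    simpa using norm_add_le (x - R.1 x) (R.1 x)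
  rw [Finset.sum_coe_sort c.support fun q => 2 * (‖c q‖ * ‖q.1.1‖) * ‖adjoint q.2 x‖]
  simp_rw [mul_assoc (2 : ℝ)]
  rw [← Finset.mul_sum]
  linarith

theorem norm_op_smul_le (x : E) (a : A) : ‖MulOpposite.op a • x‖ ≤ ‖x‖ * ‖a‖ := by
  have h : ‖MulOpposite.op a • x‖ ^ 2 ≤ ‖MulOpposite.op a • x‖ * (‖x‖ * ‖a‖) := by
    rw [norm_sq_eq_norm_rinner A, rinner_op_smul_right, ← mul_assoc]
    refine (norm_mul_le _ _).trans ?_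
    gcongr
    exact norm_rinner_le A _ _
  rcases (norm_nonneg (MulOpposite.op a • x)).eq_or_lt with h0 | h0
  · rw [← h0]; positivity
  · exact le_of_mul_le_mul_left (by rwa [sq] at h) h0

/-- The multiplier `a ↦ x a` that a vector `x ∈ E` defines; its adjoint is `y ↦ (x | y)`. -/
noncomputable def vectorMultiplier (x : E) : MultiplierModule A E :=
  ⟨LinearMap.mkContinuous
      { toFun := fun a => MulOpposite.op a • x
        map_add' := fun a b => ext_rinner_left A fun z => by
          simp only [rinner_op_smul_right, rinner_add_right, mul_add]
        map_smul' := fun c a => ext_rinner_left A fun z => by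
          rw [rinner_op_smul_right, rinner_smul_right, rinner_op_smul_right, mul_smul_comm,
            RingHom.id_apply] }
      ‖x‖ (norm_op_smul_le x),
    LinearMap.mkContinuous
      { toFun := fun y => rinner A x y
        map_add' := rinner_add_right x
        map_smul' := fun c => rinner_smul_right c x }
      ‖x‖ fun y => norm_rinner_le A x y,
    fun a y => rinner_op_smul_left x y a⟩

theorem vectorMultiplier_apply (x : E) (a : A) :
    (vectorMultiplier x).1 a = MulOpposite.op a • x := rfl

theorem norm_vectorMultiplier_le (x : E) : ‖vectorMultiplier (A := A) x‖ ≤ ‖x‖ :=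
  ContinuousLinearMap.opNorm_le_bound _ (norm_nonneg x) (norm_op_smul_le x)

/-- The orbit map `b ↦ m · b` of `m ∈ M(E)`, as a bounded operator on `M(A)`. -/
noncomputable def orbitMap (m : MultiplierModule A E) : 𝓜(ℂ, A) →L[ℂ] MultiplierModule A E :=
  LinearMap.mkContinuous
    { toFun := rightMul m
      map_add' := fun _ _ => Subtype.ext <| ContinuousLinearMap.ext fun _ => map_add m.1 _ _
      map_smul' := fun _ _ => Subtype.ext <| ContinuousLinearMap.ext fun _ => map_smul m.1 _ _ }
    ‖m‖ fun b => (m.1.opNorm_comp_le b.fst).trans_eq (by rw [DoubleCentralizer.norm_fst]; rfl)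

/-- A finite generating family of `M(E)` controls the norm of `E`: by the open mapping theorem, the
multiplier of `x ∈ E` has coefficients `bᵢ` of norm at most `C ‖x‖`, and
`(x | x) u = ∑ᵢ (mᵢ⋆ x)⋆ bᵢ u` for `u` in an approximate unit. -/
theorem hasParsevalFrame_of_finite [CompleteSpace E] (hσ : IsSigmaUnital A)
    [Module.Finite (𝓜(ℂ, A))ᵐᵒᵖ (MultiplierModule A E)] : HasParsevalFrame A E := by
  obtain ⟨u, hu, hlim⟩ := hσ
  obtain ⟨n, m, hm⟩ := Module.Finite.exists_fin (R := (𝓜(ℂ, A))ᵐᵒᵖ) (M := MultiplierModule A E)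
  let ψ : (Fin n → 𝓜(ℂ, A)) →L[ℂ] MultiplierModule A E :=
    ∑ i, (orbitMap (m i)).comp (ContinuousLinearMap.proj i)
  have hψ (b : Fin n → 𝓜(ℂ, A)) : ψ b = ∑ i, rightMul (m i) (b i) := by
    simp only [ψ, sum_apply]
    rfl
  have hsurj : Function.Surjective ψ := fun t => by
    have ht : t ∈ Submodule.span (𝓜(ℂ, A))ᵐᵒᵖ (Set.range m) := hm ▸ trivial
    obtain ⟨c, hc⟩ := (Submodule.mem_span_range_iff_exists_fun _).1 ht
    exact ⟨fun i => (c i).unop, (hψ _).trans hc⟩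
  obtain ⟨C, hC, hbd⟩ :=
    ContinuousLinearMap.exists_preimage_norm_le (σ := RingHom.id ℂ) (E := Fin n → 𝓜(ℂ, A))
      (F := MultiplierModule A E) ψ hsurj
  refine hasParsevalFrame_of_norm_le m (fun _ => C) fun x => ?_
  obtain ⟨b, hb, hbn⟩ := hbd (vectorMultiplier x)
  have hexp (a : A) : rinner A x x * a = ∑ i, rinner A (adjoint (m i) x) ((b i).fst a) := by
    have h1 : MulOpposite.op a • x = ∑ i, (m i).1 ((b i).fst a) := by
      rw [← vectorMultiplier_apply, ← hb, hψ, AddSubmonoidClass.coe_finsetSum, sum_apply]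
      rfl
    rw [← rinner_op_smul_right, h1, rinner_sum_right]
    exact Finset.sum_congr rfl fun i _ => (rinner_adjoint_left _ _ _).symm
  have hle (k : ℕ) : ‖rinner A x x * u k‖ ≤ ‖x‖ * ∑ i, C * ‖adjoint (m i) x‖ := by
    rw [hexp, Finset.mul_sum]
    refine norm_sum_le_of_le _ fun i _ => (norm_rinner_le A _ _).trans ?_
    have h1 : ‖(b i).fst (u k)‖ ≤ C * ‖x‖ := by
      calc ‖(b i).fst (u k)‖ ≤ ‖(b i).fst‖ * 1 := (b i).fst.le_opNorm_of_le (hu k).2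
        _ = ‖b i‖ := by rw [mul_one, DoubleCentralizer.norm_fst]
        _ ≤ ‖b‖ := norm_le_pi_norm b i
        _ ≤ C * ‖x‖ := hbn.trans (by gcongr; exact norm_vectorMultiplier_le x)
    calc ‖adjoint (m i) x‖ * ‖(b i).fst (u k)‖ ≤ ‖adjoint (m i) x‖ * (C * ‖x‖) := by gcongr
      _ = ‖x‖ * (C * ‖adjoint (m i) x‖) := by ring
  have hsq : ‖x‖ ^ 2 ≤ ‖x‖ * ∑ i, C * ‖adjoint (m i) x‖ := by
    rw [norm_sq_eq_norm_rinner A x]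
    exact le_of_tendsto (hlim (rinner A x x)).2.norm (.of_forall hle)
  rcases (norm_nonneg x).eq_or_lt with h0 | h0
  · rw [← h0]; positivity
  · exact le_of_mul_le_mul_left (by rwa [sq] at hsq) h0

end Characterisations
end RightHilbert

theorem theorem3p1 {A : Type*} [NonUnitalCStarAlgebra A] [PartialOrder A] [StarOrderedRing A]
    (hA : ¬ RightHilbert.HasUnit A) (hσ : RightHilbert.IsSigmaUnital A)
    (E : Type*) [NormedAddCommGroup E] [NormedSpace ℂ E] [CompleteSpace E]
    [SMul Aᵐᵒᵖ E] [CStarModule Aᵐᵒᵖ E] :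
    List.TFAE [
      ∃ F : Set 𝓜(ℂ, A), F.Finite ∧ RightHilbert.IsFiniteProjective (RightHilbert.generated F) E,
      RightHilbert.IsFiniteProjective (⊤ : NonUnitalStarSubalgebra ℂ 𝓜(ℂ, A)) E,
      Module.Finite (𝓜(ℂ, A))ᵐᵒᵖ (RightHilbert.MultiplierModule A E) ∧
        Module.Projective (𝓜(ℂ, A))ᵐᵒᵖ (RightHilbert.MultiplierModule A E),
      RightHilbert.IsLeftFull A E] := by
  have frame_of_top
      (h : RightHilbert.IsFiniteProjective (⊤ : NonUnitalStarSubalgebra ℂ 𝓜(ℂ, A)) E) :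
      RightHilbert.HasParsevalFrame A E := by
    obtain ⟨n, p, hp, -, hE⟩ := h.exists_iso
    exact RightHilbert.hasParsevalFrame_of_isoProjRange hp hE
  tfae_have 1 → 2 := fun ⟨_, _, h⟩ => h.mono le_top RightHilbert.isUnitisation_top
  tfae_have 2 → 3 := fun h => (frame_of_top h).finite_and_projective
  tfae_have 2 → 4 := fun h => (frame_of_top h).isLeftFull
  tfae_have 3 → 1 := fun ⟨_, _⟩ =>
    RightHilbert.exists_finite_isFiniteProjective_generated
      (RightHilbert.hasParsevalFrame_of_finite hσ)
  tfae_have 4 → 1 := fun h =>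
    RightHilbert.exists_finite_isFiniteProjective_generated h.hasParsevalFrame
  tfae_finish
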